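/- Model. The input consists of $n$ elements, numbered $0,\dots,n-1$, with a hidden strict total order. An algorithm is a single program (the same for all $n$) of a randomized unit-cost random access machine that is given $n$. In one time step it can perform an addition, a subtraction, a copy, a memory access or a test on natural numbers, draw a uniformly random number from $\{0,\dots,a-1\}$ for a number $a$ it holds, or compare two elements, given by their numbers. A comparison of two distinct elements reports their true order, except that it reports the wrong order with some probability at most $p$; the faults of different comparisons (including repeated comparisons of the same pair) are independent. For an integer $k$, the problem FT-Min$(k)$ asks for one of the $k$ smallest elements, and FT-Min$(\frac34 n)$ stands for FT-Min$(\lfloor \frac34 n\rfloor)$. Theorem. For every constant $p\in[0,\frac12)$ there are an algorithm and constants $C$ and $c>1$, depending only on $p$, such that for every $n\ge 3$, on every input of $n$ elements and for all fault probabilities that are at most $p$, the algorithm has expected running time at most $C\, n\log_2\log_2 n$ and returns an element that is one of the $\lfloor\frac34 n\rfloor$ smallest ones with probability at least $1-c^{-n}$. In other words, FT-Min$(\frac34 n)$ can be solved in $O(n\log\log n)$ expected time with probability $1-2^{-\Omega(n)}$. -/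

import Mathlib

open scoped ENNReal

noncomputable section

namespace FTMin

/-! ## Instances: a hidden total order with unreliable comparisons -/

/-- An instance on the `n` elements `0, …, n - 1`, with comparison faults of probability at
most `p`.  `lt` is the true strict order of the elements, and `fault j x y` is the probability
that the comparison that the algorithm performs after `j` earlier ones is answered wrongly, if it
compares `x` with `y`.  The faults are drawn independently of one another (see `compareResult`);
a constant function `fault` is the model in which every comparison fails with the same
probability. -/
structure Instance (n : ℕ) (p : ℝ) where
  lt : Fin n → Fin n → Prop
  strictTotal : IsStrictTotalOrder (Fin n) lt
  fault : ℕ → Fin n → Fin n → unitInterval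
  fault_le : ∀ j x y, (fault j x y : ℝ) ≤ p

/-- `x` is one of the `k` smallest elements: fewer than `k` elements are smaller than `x`. -/
def Instance.IsSmall {n : ℕ} {p : ℝ} (I : Instance n p) (k : ℕ) (x : Fin n) : Prop :=
  {y : Fin n | I.lt y x}.ncard < k

/-- A coin that shows `true` with probability `e`. -/
def coin (e : unitInterval) : PMF Bool :=
  PMF.ofFintype (fun b => ENNReal.ofReal (if b then (e : ℝ) else 1 - e)) (by
    rw [Fintype.sum_bool, ← ENNReal.ofReal_add]
    · simp
    · simpa using e.2.1
    · simpa using e.2.2)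

open Classical in
/-- The random answer to the question "is element `x` smaller than element `y`?", asked after `j`
earlier comparisons: the truth value, flipped with probability `fault j x y`.  Only two distinct
elements can be compared; in all other cases the answer is `false`. -/
def Instance.compareResult {n : ℕ} {p : ℝ} (I : Instance n p) (j x y : ℕ) : PMF Bool :=
  if h : x < n ∧ y < n ∧ x ≠ y then
    (coin (I.fault j ⟨x, h.1⟩ ⟨y, h.2.1⟩)).map
      (fun wrong => xor wrong (decide (I.lt ⟨x, h.1⟩ ⟨y, h.2.1⟩)))
  else PMF.pure false

/-! ## The machine: a randomized RAM with unit cost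

The machine has registers and an indexed memory, both holding natural numbers, and works on the
elements only through their indices.  Its arithmetic is addition and (truncated) subtraction. -/

/-- Elementary instructions; `r`, `a`, `b` are names of registers. -/
inductive Instr where
  /-- put the constant `k` into `r` -/
  | const (r k : ℕ)
  /-- copy `a` to `r` -/
  | move (r a : ℕ)
  /-- put `a + b` into `r` -/
  | add (r a b : ℕ)
  /-- put `max (a - b) 0` into `r` -/
  | sub (r a b : ℕ)
  /-- load into `r` the memory cell whose address is in `a` -/
  | load (r a : ℕ)
  /-- store `b` in the memory cell whose address is in `a` -/
  | store (a b : ℕ)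
  /-- put into `r` a uniformly random number from `{0, …, a - 1}` (and `0` if `a = 0`) -/
  | rand (r a : ℕ)
  /-- compare the elements with indices `a` and `b`, and put `1` into `r` if the first one
  is reported to be smaller, and `0` otherwise -/
  | cmp (r a b : ℕ)

/-- Programs. The guards of `ite` and `loop` test whether register `a` is less than register
`b`. -/
inductive Prog where
  | skip
  | instr (i : Instr)
  | seq (P Q : Prog)
  | ite (a b : ℕ) (P Q : Prog)
  | loop (a b : ℕ) (P : Prog)

/-- Contents of the registers and of the memory, and the number of comparisons performed so far
(which the program cannot read). -/
structure State where
  reg : ℕ → ℕ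
  mem : ℕ → ℕ
  cmps : ℕ

/-- Write `v` into register `r`. -/
def State.setReg (s : State) (r v : ℕ) : State :=
  { s with reg := Function.update s.reg r v }

/-- Uniform distribution on `{0, …, k - 1}`; the point mass at `0` for `k = 0`. -/
def uniformBelow (k : ℕ) : PMF ℕ :=
  if h : 0 < k then PMF.uniformOfFinset (Finset.range k) ⟨0, Finset.mem_range.2 h⟩
  else PMF.pure 0

/-- Effect of one elementary instruction. -/
def Instr.run {n : ℕ} {p : ℝ} (I : Instance n p) (s : State) : Instr → PMF State
  | .const r k => PMF.pure (s.setReg r k)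
  | .move r a => PMF.pure (s.setReg r (s.reg a))
  | .add r a b => PMF.pure (s.setReg r (s.reg a + s.reg b))
  | .sub r a b => PMF.pure (s.setReg r (s.reg a - s.reg b))
  | .load r a => PMF.pure (s.setReg r (s.mem (s.reg a)))
  | .store a b => PMF.pure { s with mem := Function.update s.mem (s.reg a) (s.reg b) }
  | .rand r a => (uniformBelow (s.reg a)).map (fun v => s.setReg r v)
  | .cmp r a b => (I.compareResult s.cmps (s.reg a) (s.reg b)).map
      (fun ans => { s.setReg r (if ans then 1 else 0) with cmps := s.cmps + 1 })

/-- A configuration: the stack of programs that are still to be executed, the first one being the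
next, and the state. -/
abbrev Config := List Prog × State

/-- The machine has halted when nothing is left to be executed. -/
def Halted (c : Config) : Prop := c.1 = []

/-- One computation step: it executes an elementary instruction, evaluates a guard, or
unfolds a sequential composition. A halted configuration no longer changes. -/
def step {n : ℕ} {p : ℝ} (I : Instance n p) : Config → PMF Config
  | ([], s) => PMF.pure ([], s)
  | (.skip :: K, s) => PMF.pure (K, s)
  | (.instr i :: K, s) => (i.run I s).map (fun s' => (K, s'))
  | (.seq P Q :: K, s) => PMF.pure (P :: Q :: K, s)
  | (.ite a b P Q :: K, s) =>
      PMF.pure (if s.reg a < s.reg b then (P :: K, s) else (Q :: K, s))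
  | (.loop a b P :: K, s) =>
      PMF.pure (if s.reg a < s.reg b then (P :: .loop a b P :: K, s) else (K, s))

/-- Initially register `0` holds the number `n` of elements; everything else is `0`. -/
def initState (n : ℕ) : State where
  reg := fun r => if r = 0 then n else 0
  mem := fun _ => 0
  cmps := 0

/-- Distribution of the configuration after `t` steps of program `P` on instance `I`. -/
def configAfter {n : ℕ} {p : ℝ} (P : Prog) (I : Instance n p) : ℕ → PMF Config
  | 0 => PMF.pure ([P], initState n)
  | t + 1 => (configAfter P I t).bind (step I)

/-- Expected running time, i.e. the expected number of executed steps: step number `t + 1` is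
executed iff the machine has not halted after `t` steps.  It is `∞` if the machine fails to halt
with positive probability. -/
def expectedTime {n : ℕ} {p : ℝ} (P : Prog) (I : Instance n p) : ℝ≥0∞ :=
  ∑' t : ℕ, (configAfter P I t).toOuterMeasure {c | ¬ Halted c}

/-- Probability that `P` halts with the index of one of the `k` smallest elements in register
`0`.  (These events increase with the number `t` of steps.) -/
def successProb {n : ℕ} {p : ℝ} (P : Prog) (I : Instance n p) (k : ℕ) : ℝ≥0∞ :=
  ⨆ t : ℕ, (configAfter P I t).toOuterMeasure
    {c | Halted c ∧ ∃ x : Fin n, c.2.reg 0 = (x : ℕ) ∧ I.IsSmall k x}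

end FTMin

end

/-!
The algorithm repeats trials until one is accepted.  A trial draws a random candidate `x` and lets
every element `y` have a duel with it: `x` loses the duel if all of `k` comparisons report that `y`
is smaller.  The candidate is accepted if it has lost fewer than `n / d` duels.

A smaller element wins its duel against `x` with probability at least `q = (1 - p) ^ k`, and any
other element with probability at most `p ^ k`.  As `p < 1 / 2`, there is a `k` for which `p ^ k` is
much smaller than `q`, and then `d ≈ 4 / q` separates the two cases.

* A candidate with fewer than `n / (12 d)` smaller elements has so few losses in expectation that
  it is accepted with probability at least `1 / 2`, by Markov's inequality
  (`cost_scan_le_of_rank_small`).  A random candidate is of this kind with probability at least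
  `1 / (12 d)` (`average_rank_le`), so the expected number of trials is bounded.  A trial takes time
  `O(n)`; hence the expected running time is even linear in `n`.
* A candidate that is not among the `3 n / 4` smallest elements is accepted with exponentially
  small probability, by an exponential moment bound (`cost_scan_le_of_rank_large`).

Both bounds hold whatever the number of earlier comparisons is, so the trials need not be
identically distributed.  A single induction gives the running time and the probability of a wrong
output: both are expected costs (`cost`), with a cost for each step in one case, and for wrong
outputs in the other.  These expected costs are only ever bounded from above; the lower bound for
the probability of success follows since the program halts almost surely
(`one_le_successProb_add_cost`).  The rules for the cost of the single constructs of the language,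
and for loops (`cost_loop_le_of_invariant`), reduce everything to `cost_search_le`, in which the
value `v` for the remaining trials is chosen proportional to `n` for the running time, and as
`c⁻ⁿ` for the probability of a wrong output.
-/

noncomputable section

namespace FTMin

/-! ### Expectations of nonnegative functions -/

/-- The expectation of `g` under `μ`. -/
def mean {α : Type*} (μ : PMF α) (g : α → ℝ≥0∞) : ℝ≥0∞ := ∑' a, μ a * g a

theorem mean_mono {α : Type*} (μ : PMF α) {g h : α → ℝ≥0∞} (hgh : ∀ a, g a ≤ h a) :
    mean μ g ≤ mean μ h :=
  ENNReal.tsum_le_tsum fun a => mul_le_mul_right (hgh a) _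

theorem mean_add {α : Type*} (μ : PMF α) (g h : α → ℝ≥0∞) :
    mean μ (fun a => g a + h a) = mean μ g + mean μ h := by
  simp only [mean, mul_add, ENNReal.tsum_add]

@[simp] theorem mean_pure {α : Type*} (a : α) (g : α → ℝ≥0∞) : mean (PMF.pure a) g = g a := by
  unfold mean
  rw [tsum_eq_single a]
  · simp
  · intro b hb
    simp [hb]

theorem mean_bind {α β : Type*} (μ : PMF α) (κ : α → PMF β) (g : β → ℝ≥0∞) :
    mean (μ.bind κ) g = mean μ (fun a => mean (κ a) g) := by
  simp only [mean, PMF.bind_apply, ← ENNReal.tsum_mul_right, ← ENNReal.tsum_mul_left]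
  rw [ENNReal.tsum_comm]
  simp only [mul_assoc]

@[simp] theorem mean_map {α β : Type*} (μ : PMF α) (φ : α → β) (g : β → ℝ≥0∞) :
    mean (μ.map φ) g = mean μ (fun a => g (φ a)) := by
  rw [← PMF.bind_pure_comp, mean_bind]
  simp

theorem toOuterMeasure_eq_mean {α : Type*} (μ : PMF α) (S : Set α) :
    μ.toOuterMeasure S = mean μ (S.indicator 1) := by
  rw [PMF.toOuterMeasure_apply, mean]
  refine tsum_congr fun a => ?_
  by_cases h : a ∈ S <;> simp [h]

theorem mean_bool (μ : PMF Bool) (g : Bool → ℝ≥0∞) :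
    mean μ g = μ true * g true + μ false * g false := by
  rw [mean, tsum_bool, add_comm]

theorem mean_uniformBelow {k : ℕ} (hk : 0 < k) (g : ℕ → ℝ≥0∞) :
    mean (uniformBelow k) g = (k : ℝ≥0∞)⁻¹ * ∑ v ∈ Finset.range k, g v := by
  rw [mean, uniformBelow, dif_pos hk, tsum_eq_sum (s := Finset.range k), Finset.mul_sum]
  · exact Finset.sum_congr rfl fun v hv => congrArg (· * g v)
      ((PMF.uniformOfFinset_apply_of_mem ⟨0, Finset.mem_range.2 hk⟩ hv).trans
        (by rw [Finset.card_range]))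
  · exact fun v hv => (congrArg (· * g v)
      (PMF.uniformOfFinset_apply_of_notMem ⟨0, Finset.mem_range.2 hk⟩ hv)).trans (zero_mul _)

/-! ### Expected cost of a computation -/

variable {n : ℕ} {p : ℝ}

/-- The expected cost of the first `t` steps from a configuration, if every executed step costs
`κ` and halting in state `s` costs a further `f s`.  For `κ = 1` and `f = 0` it is a truncated
expected running time, and for `κ = 0` and an indicator function `f` it is the probability to have
halted within `t` steps in a given set of states. -/
def costWithin (I : Instance n p) (κ : ℝ≥0∞) (f : State → ℝ≥0∞) : ℕ → Config → ℝ≥0∞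
  | 0, c => if c.1 = [] then f c.2 else 0
  | t + 1, c => (if c.1 = [] then 0 else κ) + mean (step I c) (costWithin I κ f t)

/-- The expected cost of the whole computation from a configuration, with `κ` and `f` as in
`costWithin`. -/
def cost (I : Instance n p) (κ : ℝ≥0∞) (f : State → ℝ≥0∞) (c : Config) : ℝ≥0∞ :=
  ⨆ t, costWithin I κ f t c

variable {I : Instance n p} {κ : ℝ≥0∞} {f : State → ℝ≥0∞}

theorem costWithin_le_cost (t : ℕ) (c : Config) : costWithin I κ f t c ≤ cost I κ f c :=
  le_iSup (fun t => costWithin I κ f t c) t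

@[simp] theorem costWithin_nil (t : ℕ) (s : State) : costWithin I κ f t ([], s) = f s := by
  induction t with
  | zero => simp [costWithin]
  | succ t ih => simp [costWithin, step, ih]

theorem costWithin_succ_cons (t : ℕ) (Q : Prog) (K : List Prog) (s : State) :
    costWithin I κ f (t + 1) (Q :: K, s)
      = κ + mean (step I (Q :: K, s)) (costWithin I κ f t) := by
  simp [costWithin]

theorem costWithin_le_succ (t : ℕ) (c : Config) :
    costWithin I κ f t c ≤ costWithin I κ f (t + 1) c := by
  induction t generalizing c with
  | zero =>
    obtain ⟨_ | ⟨Q, K⟩, s⟩ := c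
    · simp
    · simp [costWithin]
  | succ t ih =>
    rw [costWithin, costWithin]
    exact add_le_add_right (mean_mono _ ih) _

theorem costWithin_mono (c : Config) : Monotone fun t => costWithin I κ f t c :=
  monotone_nat_of_le_succ fun t => costWithin_le_succ t c

@[simp] theorem cost_nil (s : State) : cost I κ f ([], s) = f s := by
  simp [cost]

theorem cost_cons_le (Q : Prog) (K : List Prog) (s : State) :
    cost I κ f (Q :: K, s) ≤ κ + mean (step I (Q :: K, s)) (cost I κ f) := by
  refine iSup_le fun t => (costWithin_le_succ t _).trans ?_
  rw [costWithin_succ_cons]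
  exact add_le_add_right (mean_mono _ (costWithin_le_cost t)) _

theorem cost_skip_le (K : List Prog) (s : State) :
    cost I κ f (.skip :: K, s) ≤ κ + cost I κ f (K, s) := by
  simpa [step] using cost_cons_le (I := I) (κ := κ) (f := f) .skip K s

theorem cost_seq_le (P Q : Prog) (K : List Prog) (s : State) :
    cost I κ f (.seq P Q :: K, s) ≤ κ + cost I κ f (P :: Q :: K, s) := by
  simpa [step] using cost_cons_le (I := I) (κ := κ) (f := f) (.seq P Q) K s

theorem cost_ite_le (a b : ℕ) (P Q : Prog) (K : List Prog) (s : State) :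
    cost I κ f (.ite a b P Q :: K, s)
      ≤ κ + cost I κ f ((if s.reg a < s.reg b then P else Q) :: K, s) := by
  have h := cost_cons_le (I := I) (κ := κ) (f := f) (.ite a b P Q) K s
  by_cases hab : s.reg a < s.reg b <;> simpa [step, hab] using h

theorem cost_loop_le (a b : ℕ) (P : Prog) (K : List Prog) (s : State) :
    cost I κ f (.loop a b P :: K, s)
      ≤ κ + cost I κ f (if s.reg a < s.reg b then P :: .loop a b P :: K else K, s) := by
  have h := cost_cons_le (I := I) (κ := κ) (f := f) (.loop a b P) K s
  by_cases hab : s.reg a < s.reg b <;> simpa [step, hab] using h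

theorem cost_instr_le (i : Instr) (K : List Prog) (s : State) :
    cost I κ f (.instr i :: K, s) ≤ κ + mean (i.run I s) (fun s' => cost I κ f (K, s')) := by
  simpa [step] using cost_cons_le (I := I) (κ := κ) (f := f) (.instr i) K s

/-- Executing `K₁ ++ K₂` means executing `K₁` and then `K₂`; on the right-hand side the
cost of `K₂` is charged when `K₁` halts. -/
theorem costWithin_append_le (K₁ K₂ : List Prog) {t m : ℕ} (htm : t ≤ m) (s : State) :
    costWithin I κ f t (K₁ ++ K₂, s)
      ≤ costWithin I κ (fun s' => costWithin I κ f m (K₂, s')) t (K₁, s) := by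
  induction t generalizing K₁ s with
  | zero =>
    cases K₁ with
    | nil => simpa using costWithin_mono _ htm
    | cons Q K => simp [costWithin]
  | succ t ih =>
    cases K₁ with
    | nil => simpa using costWithin_mono _ htm
    | cons Q K =>
      have ih' := fun K s => ih K (Nat.le_of_succ_le htm) s
      rw [List.cons_append, costWithin_succ_cons, costWithin_succ_cons]
      refine add_le_add_right ?_ _
      cases Q with
      | skip => simpa [step] using ih' K s
      | instr i => simpa [step] using mean_mono _ fun s' => ih' K s'
      | seq P Q => simpa [step] using ih' (P :: Q :: K) s
      | ite a b P Q =>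
        by_cases hab : s.reg a < s.reg b
        · simpa [step, hab] using ih' (P :: K) s
        · simpa [step, hab] using ih' (Q :: K) s
      | loop a b P =>
        by_cases hab : s.reg a < s.reg b
        · simpa [step, hab] using ih' (P :: .loop a b P :: K) s
        · simpa [step, hab] using ih' K s

/-- Induction for unbounded loops: with `J` as loop invariant, `v` bounds the expected cost of a
loop that is entered if it bounds the cost of one execution of the body that is followed by any
cost `g` satisfying this bound. -/
theorem cost_loop_le_of_invariant {a b : ℕ} {P : Prog} (J : State → Prop) (v : ℝ≥0∞)
    (body : ∀ g : State → ℝ≥0∞, (∀ s, J s → g s ≤ if s.reg a < s.reg b then v else κ + f s) →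
      ∀ s, J s → s.reg a < s.reg b → κ + cost I κ g ([P], s) ≤ v)
    {s : State} (hs : J s) (hab : s.reg a < s.reg b) : cost I κ f ([.loop a b P], s) ≤ v := by
  refine iSup_le fun t => ?_
  suffices h : ∀ s, J s → costWithin I κ f t ([.loop a b P], s)
      ≤ if s.reg a < s.reg b then v else κ + f s by simpa [hab] using h s hs
  clear hs hab s
  induction t with
  | zero => simp [costWithin]
  | succ t ih =>
    intro s hs
    rw [costWithin_succ_cons]
    by_cases h : s.reg a < s.reg b
    · refine le_trans ?_ ((body _ ih s hs h).trans_eq (if_pos h).symm)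
      refine add_le_add_right ?_ _
      simp only [step, h, if_true, mean_pure]
      exact (costWithin_append_le [P] [.loop a b P] le_rfl s).trans (costWithin_le_cost _ _)
    · simp [step, h]

/-! ### Running time and success probability in terms of expected costs -/

theorem costWithin_add_eq (P : Prog) (i j : ℕ) :
    costWithin I κ f (i + j) ([P], initState n)
      = κ * ∑ t ∈ Finset.range i, (configAfter P I t).toOuterMeasure {c | ¬ Halted c}
        + mean (configAfter P I i) (costWithin I κ f j) := by
  induction i generalizing j with
  | zero => simp [configAfter]
  | succ i ih =>
    have key : costWithin I κ f (j + 1)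
        = fun c => κ * Set.indicator {c | ¬ Halted c} 1 c + mean (step I c) (costWithin I κ f j) := by
      funext c
      by_cases hc : c.1 = [] <;> simp [costWithin, Halted, hc]
    have hκ : mean (configAfter P I i) (fun c => κ * Set.indicator {c | ¬ Halted c} 1 c)
        = κ * (configAfter P I i).toOuterMeasure {c | ¬ Halted c} := by
      rw [toOuterMeasure_eq_mean, mean, mean, ← ENNReal.tsum_mul_left]
      exact tsum_congr fun c => mul_left_comm _ _ _
    rw [show i + 1 + j = i + (j + 1) by ring, ih, key, mean_add, hκ, Finset.sum_range_succ,
      mul_add, add_assoc, configAfter, mean_bind]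

theorem expectedTime_le_cost (P : Prog) :
    expectedTime P I ≤ cost I 1 (fun _ => 0) ([P], initState n) := by
  rw [expectedTime, ENNReal.tsum_eq_iSup_nat]
  refine iSup_le fun t => le_trans ?_ (costWithin_le_cost t _)
  have h := costWithin_add_eq (I := I) (κ := 1) (f := fun _ => 0) P t 0
  rw [add_zero, one_mul] at h
  rw [h]
  exact le_self_add

open Classical in
/-- The cost of an output: `0` for one of the `k` smallest elements, and `1` otherwise. -/
def wrongOutput (I : Instance n p) (k : ℕ) (s : State) : ℝ≥0∞ :=
  if ∃ x : Fin n, s.reg 0 = (x : ℕ) ∧ I.IsSmall k x then 0 else 1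

theorem one_le_successProb_add_cost (P : Prog) (k : ℕ) (hfin : expectedTime P I ≠ ∞) :
    1 ≤ successProb P I k + cost I 0 (wrongOutput I k) ([P], initState n) := by
  have htend := ENNReal.tendsto_atTop_zero_of_tsum_ne_top hfin
  have hle : ∀ t, (1 : ℝ≥0∞) ≤ (configAfter P I t).toOuterMeasure {c | ¬ Halted c}
      + (successProb P I k + cost I 0 (wrongOutput I k) ([P], initState n)) := by
    intro t
    have h := costWithin_add_eq (I := I) (κ := 0) (f := wrongOutput I k) P t 0
    have hone : mean (configAfter P I t) (fun _ => 1) = 1 := by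
      simp [mean, PMF.tsum_coe]
    calc (1 : ℝ≥0∞) = mean (configAfter P I t) (fun _ => 1) := hone.symm
      _ ≤ mean (configAfter P I t) (fun c => Set.indicator {c | ¬ Halted c} 1 c
          + (Set.indicator {c | Halted c ∧ ∃ x : Fin n, c.2.reg 0 = (x : ℕ) ∧ I.IsSmall k x} 1 c
          + costWithin I 0 (wrongOutput I k) 0 c)) := by
        refine mean_mono _ fun c => ?_
        by_cases hc : c.1 = []
        · by_cases hx : ∃ x : Fin n, c.2.reg 0 = (x : ℕ) ∧ I.IsSmall k x
          · simp [Halted, hc, hx]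
          · simp [Halted, hc, hx, costWithin, wrongOutput]
        · simp [Halted, hc]
      _ ≤ _ := by
        rw [mean_add, mean_add, ← toOuterMeasure_eq_mean, ← toOuterMeasure_eq_mean]
        refine add_le_add_right (add_le_add ?_ ?_) _
        · exact le_iSup (fun t => (configAfter P I t).toOuterMeasure
            {c | Halted c ∧ ∃ x : Fin n, c.2.reg 0 = (x : ℕ) ∧ I.IsSmall k x}) t
        · refine le_trans ?_ (costWithin_le_cost t _)
          rw [add_zero] at h
          rw [h]
          exact le_add_self
  have := ge_of_tendsto (htend.add_const _) (Filter.Eventually.of_forall hle)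
  simpa using this

/-! ### The program -/

/-- Compare the element in register `5` with the candidate in register `0` up to `k` times, until
an answer says that it is not the smaller one; if there is no such answer, add register `3` to the
loss of the candidate, which is kept in register `4`. -/
def duel : ℕ → Prog
  | 0 => .instr (.add 4 4 3)
  | k + 1 => .seq (.instr (.cmp 6 5 0)) (.ite 6 2 .skip (duel k))

/-- Let all elements from the one in register `5` on have a duel with the candidate. -/
def scan (k : ℕ) : Prog := .loop 5 1 (.seq (duel k) (.instr (.add 5 5 2)))

/-- Draw a candidate, and determine its loss. -/
def trial (k : ℕ) : Prog :=
  .seq (.instr (.rand 0 1)) (.seq (.instr (.const 4 1)) (.seq (.instr (.const 5 0)) (scan k)))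

/-- Try candidates until the loss of one is at most the number of elements.  Registers `1`, `2`
and `3` hold the number of elements, `1` and `d`.  The loss is `1` plus `d` times the number of lost
duels; its initial value lets the loop start. -/
def search (k d : ℕ) : Prog :=
  .seq (.instr (.move 1 0)) (.seq (.instr (.const 2 1)) (.seq (.instr (.const 3 d))
    (.seq (.instr (.add 4 1 2)) (.loop 1 4 (trial k)))))

/-- The registers that `search` never changes after its initialization have the right values. -/
structure Ready (n d : ℕ) (s : State) : Prop where
  size : s.reg 1 = n
  one : s.reg 2 = 1
  unit : s.reg 3 = d

/-- The candidate is `x`, the element next to be compared with it is `y`, and the loss is `l`. -/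
structure Scanning (n d x y l : ℕ) (s : State) : Prop extends Ready n d s where
  candidate : s.reg 0 = x
  loss : s.reg 4 = l
  next : s.reg 5 = y

/-- The number `y` stands for a smaller element than `x`. -/
def Instance.Below (I : Instance n p) (y x : ℕ) : Prop :=
  ∃ (hy : y < n) (hx : x < n), I.lt ⟨y, hy⟩ ⟨x, hx⟩

open Classical in
/-- The number of elements that are smaller than `x`. -/
def Instance.rank (I : Instance n p) (x : ℕ) : ℕ := ((Finset.range n).filter (I.Below · x)).card

theorem Instance.rank_eq_ncard (I : Instance n p) (x : Fin n) :
    I.rank x = {y : Fin n | I.lt y x}.ncard := by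
  classical
  rw [Instance.rank, ← Set.ncard_image_of_injective _ Fin.val_injective, ← Set.ncard_coe_finset]
  congr 1
  ext y
  rw [Finset.mem_coe, Finset.mem_filter, Finset.mem_range]
  constructor
  · rintro ⟨-, hy, hx, h⟩
    exact ⟨⟨y, hy⟩, h, rfl⟩
  · rintro ⟨z, hz : I.lt z x, rfl⟩
    exact ⟨z.2, z.2, x.2, hz⟩

/-- Distinct elements have distinct ranks, so all the numbers below `n` are ranks. -/
theorem Instance.le_card_rank_lt (I : Instance n p) {m : ℕ} (hm : m ≤ n) :
    m ≤ ((Finset.range n).filter (I.rank · < m)).card := by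
  classical
  have := I.strictTotal
  have hmono : ∀ x y : Fin n, I.lt x y → I.rank x < I.rank y := by
    intro x y hxy
    rw [I.rank_eq_ncard, I.rank_eq_ncard]
    refine Set.ncard_lt_ncard ⟨fun z hz => _root_.trans hz hxy, fun h => ?_⟩ (Set.toFinite _)
    exact irrefl_of I.lt x (h hxy)
  have hlt : ∀ x : Fin n, I.rank x < n := by
    intro x
    rw [I.rank_eq_ncard]
    have h : {y : Fin n | I.lt y x}.ncard < (Set.univ : Set (Fin n)).ncard :=
      Set.ncard_lt_ncard ⟨Set.subset_univ _, fun h => irrefl_of I.lt x (h (Set.mem_univ x))⟩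
        (Set.toFinite _)
    simpa [Set.ncard_univ] using h
  have hinj : Function.Injective fun x : Fin n => (⟨I.rank x, hlt x⟩ : Fin n) := by
    intro x y hxy
    have hxy' : I.rank x = I.rank y := congrArg Fin.val hxy
    rcases trichotomous_of I.lt x y with h | h | h
    · exact absurd hxy' (hmono x y h).ne
    · exact h
    · exact absurd hxy' (hmono y x h).ne'
  have hsurj := Finite.surjective_of_injective hinj
  have hsub : Finset.range m ⊆ ((Finset.range n).filter (I.rank · < m)).image I.rank := by
    intro i hi
    have hi := Finset.mem_range.1 hi
    obtain ⟨x, hx⟩ := hsurj ⟨i, hi.trans_le hm⟩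
    have hx : I.rank x = i := congrArg Fin.val hx
    exact Finset.mem_image.2 ⟨x, by simp [hx, hi], hx⟩
  calc m = (Finset.range m).card := (Finset.card_range m).symm
    _ ≤ _ := Finset.card_le_card hsub
    _ ≤ _ := Finset.card_image_le

/-! ### The outcome of a duel -/

theorem coin_apply_true (e : unitInterval) : coin e true = ENNReal.ofReal e := by
  simp [coin]

theorem coin_apply_false (e : unitInterval) : coin e false = ENNReal.ofReal (1 - e) := by
  simp [coin]

theorem compareResult_true_add_false (I : Instance n p) (j y x : ℕ) :
    I.compareResult j y x true + I.compareResult j y x false = 1 := by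
  rw [← (I.compareResult j y x).tsum_coe, tsum_bool, add_comm]

theorem le_compareResult_of_below (I : Instance n p) (j : ℕ) {y x : ℕ} (h : I.Below y x) :
    ENNReal.ofReal (1 - p) ≤ I.compareResult j y x true := by
  obtain ⟨hy, hx, hlt⟩ := h
  have := I.strictTotal
  have hne : y ≠ x := by
    rintro rfl
    exact irrefl_of I.lt _ hlt
  have hmap : I.compareResult j y x true = coin (I.fault j ⟨y, hy⟩ ⟨x, hx⟩) false := by
    rw [Instance.compareResult, dif_pos ⟨hy, hx, hne⟩, PMF.map_apply, tsum_bool]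
    simp [hlt]
  rw [hmap, coin_apply_false]
  exact ENNReal.ofReal_le_ofReal (by linarith [I.fault_le j ⟨y, hy⟩ ⟨x, hx⟩])

theorem compareResult_le_of_not_below (I : Instance n p) (j : ℕ) {y x : ℕ} (h : ¬ I.Below y x) :
    I.compareResult j y x true ≤ ENNReal.ofReal p := by
  by_cases hd : y < n ∧ x < n ∧ y ≠ x
  · have hlt : ¬ I.lt ⟨y, hd.1⟩ ⟨x, hd.2.1⟩ := fun hlt => h ⟨_, _, hlt⟩
    have hmap : I.compareResult j y x true = coin (I.fault j ⟨y, hd.1⟩ ⟨x, hd.2.1⟩) true := by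
      rw [Instance.compareResult, dif_pos hd, PMF.map_apply, tsum_bool]
      simp [hlt]
    rw [hmap, coin_apply_true]
    exact ENNReal.ofReal_le_ofReal (I.fault_le _ _ _)
  · rw [Instance.compareResult, dif_neg hd]
    simp

variable {d x y l : ℕ}

theorem Scanning.afterCmp {s : State} (hs : Scanning n d x y l s) (v c : ℕ) :
    Scanning n d x y l { s.setReg 6 v with cmps := c } := by
  obtain ⟨⟨h1, h2, h3⟩, h4, h5, h6⟩ := hs
  constructor <;> try constructor
  all_goals simpa [State.setReg]

/-- The candidate loses a duel with some probability `v`, which is large if the opponent is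
smaller, and small otherwise. The bounds `A` and `B` are for what follows a won and a lost
duel. -/
theorem cost_duel_le (k : ℕ) {K : List Prog} {A B : ℝ≥0∞}
    (hA : ∀ s, Scanning n d x y l s → cost I κ f (K, s) ≤ A)
    (hB : ∀ s, Scanning n d x y (l + d) s → cost I κ f (K, s) ≤ B)
    {s : State} (hs : Scanning n d x y l s) :
    ∃ u v : ℝ≥0∞, u + v = 1 ∧ (I.Below y x → ENNReal.ofReal (1 - p) ^ k ≤ v) ∧
      (¬ I.Below y x → v ≤ ENNReal.ofReal p ^ k) ∧
      cost I κ f (duel k :: K, s) ≤ κ * (3 * k + 1 : ℕ) + (u * A + v * B) := by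
  induction k generalizing s with
  | zero =>
    refine ⟨0, 1, by simp, by simp, by simp, (cost_instr_le _ _ _).trans ?_⟩
    simp only [Instr.run, mean_pure]
    have := hB (s.setReg 4 (s.reg 4 + s.reg 3)) (by
      obtain ⟨⟨h1, h2, h3⟩, h4, h5, h6⟩ := hs
      constructor <;> try constructor
      all_goals simp [State.setReg, *])
    simpa using add_le_add_right this κ
  | succ k ih =>
    obtain ⟨u, v, huv, hv1, hv2, hcost⟩ := ih (hs.afterCmp 1 (s.cmps + 1))
    have hcost' := hA _ (hs.afterCmp 0 (s.cmps + 1))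
    set e := I.compareResult s.cmps y x true with he
    set e' := I.compareResult s.cmps y x false with he'
    have hee : e + e' = 1 := compareResult_true_add_false I _ _ _
    refine ⟨e' + e * u, e * v, ?_, fun h => ?_, fun h => ?_, ?_⟩
    · rw [add_assoc, ← mul_add, huv, mul_one, add_comm, hee]
    · rw [pow_succ']
      exact mul_le_mul' (le_compareResult_of_below I _ h) (hv1 h)
    · rw [pow_succ']
      exact mul_le_mul' (compareResult_le_of_not_below I _ h) (hv2 h)
    · have htrue : cost I κ f (.ite 6 2 .skip (duel k) :: K,
          { s.setReg 6 1 with cmps := s.cmps + 1 })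
          ≤ κ * (3 * k + 2 : ℕ) + (u * A + v * B) := by
        refine (cost_ite_le _ _ _ _ _ _).trans ?_
        have : ¬ (s.setReg 6 1).reg 6 < (s.setReg 6 1).reg 2 := by simp [State.setReg, hs.one]
        simp only [this, if_false]
        refine (add_le_add_right hcost _).trans_eq ?_
        push_cast
        ring
      have hfalse : cost I κ f (.ite 6 2 .skip (duel k) :: K,
          { s.setReg 6 0 with cmps := s.cmps + 1 }) ≤ κ * (3 * k + 2 : ℕ) + A := by
        refine (cost_ite_le _ _ _ _ _ _).trans ?_
        have : (s.setReg 6 0).reg 6 < (s.setReg 6 0).reg 2 := by simp [State.setReg, hs.one]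
        simp only [this, if_true]
        refine (add_le_add_right ((cost_skip_le _ _).trans (add_le_add_right hcost' _)) _).trans ?_
        rw [← add_assoc]
        refine add_le_add_left ?_ _
        rw [← two_mul, mul_comm]
        exact mul_le_mul_right (by norm_cast; omega) _
      calc cost I κ f (duel (k + 1) :: K, s)
          ≤ κ + (κ + (e * (κ * (3 * k + 2 : ℕ) + (u * A + v * B))
              + e' * (κ * (3 * k + 2 : ℕ) + A))) := by
            refine (cost_seq_le _ _ _ _).trans (add_le_add_right ?_ _)
            refine (cost_instr_le _ _ _).trans (add_le_add_right ?_ _)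
            simp only [Instr.run, mean_map, mean_bool, hs.candidate, hs.next, if_true]
            exact add_le_add (mul_le_mul_right htrue _) (mul_le_mul_right (by simpa using hfalse) _)
        _ = κ + (κ + ((e + e') * (κ * (3 * k + 2 : ℕ)) + ((e' + e * u) * A + e * v * B))) := by
            ring
        _ = κ * (3 * (k + 1) + 1 : ℕ) + ((e' + e * u) * A + e * v * B) := by
            rw [hee]
            push_cast
            ring

/-! ### The loss of a candidate -/

/-- One pass of the loop `scan`: `A` and `B` bound the cost of the rest of the loop after a won
and a lost duel. -/
theorem cost_scan_le_of_lt (k : ℕ) {K : List Prog} {A B : ℝ≥0∞} (hy : y < n)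
    (hA : ∀ s, Scanning n d x (y + 1) l s → cost I κ f (scan k :: K, s) ≤ A)
    (hB : ∀ s, Scanning n d x (y + 1) (l + d) s → cost I κ f (scan k :: K, s) ≤ B)
    {s : State} (hs : Scanning n d x y l s) :
    ∃ u v : ℝ≥0∞, u + v = 1 ∧ (I.Below y x → ENNReal.ofReal (1 - p) ^ k ≤ v) ∧
      (¬ I.Below y x → v ≤ ENNReal.ofReal p ^ k) ∧
      cost I κ f (scan k :: K, s) ≤ κ * (3 * k + 4 : ℕ) + (u * A + v * B) := by
  have hinc : ∀ l (C : ℝ≥0∞),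
      (∀ s, Scanning n d x (y + 1) l s → cost I κ f (scan k :: K, s) ≤ C) →
      ∀ s, Scanning n d x y l s → cost I κ f (.instr (.add 5 5 2) :: scan k :: K, s) ≤ κ + C := by
    intro l C hC s hs
    refine (cost_instr_le _ _ _).trans (add_le_add_right ?_ _)
    simp only [Instr.run, mean_pure]
    refine hC _ ?_
    obtain ⟨⟨h1, h2, h3⟩, h4, h5, h6⟩ := hs
    constructor <;> try constructor
    all_goals simp [State.setReg, *]
  obtain ⟨u, v, huv, hv1, hv2, hcost⟩ := cost_duel_le k (hinc _ _ hA) (hinc _ _ hB) hs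
  refine ⟨u, v, huv, hv1, hv2, ?_⟩
  calc cost I κ f (scan k :: K, s)
      ≤ κ + (κ + (κ * (3 * k + 1 : ℕ) + (u * (κ + A) + v * (κ + B)))) := by
        refine (cost_loop_le _ _ _ _ _).trans (add_le_add_right ?_ _)
        rw [if_pos (by rw [hs.next, hs.size]; exact hy)]
        exact (cost_seq_le _ _ _ _).trans (add_le_add_right hcost _)
    _ = κ + (κ + (κ * (3 * k + 1 : ℕ) + ((u + v) * κ + (u * A + v * B)))) := by ring
    _ = _ := by
        rw [huv]
        push_cast
        ring

theorem cost_scan_le_of_eq (k : ℕ) {K : List Prog} {s : State} (hs : Scanning n d x n l s) :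
    cost I κ f (scan k :: K, s) ≤ κ + cost I κ f (K, s) := by
  have h := cost_loop_le (I := I) (κ := κ) (f := f) 5 1 (.seq (duel k) (.instr (.add 5 5 2))) K s
  rwa [if_neg (by rw [hs.next, hs.size]; exact lt_irrefl n)] at h

open Classical in
/-- Exponential moment of the loss: each smaller opponent contributes a factor `ρ`. -/
theorem cost_scan_le_exp (k : ℕ) {K : List Prog} {a b σ ρ : ℝ≥0∞} (hσ : σ ≤ 1)
    (hρ : ∀ u v : ℝ≥0∞, u + v = 1 → ENNReal.ofReal (1 - p) ^ k ≤ v → u + v * σ ^ d ≤ ρ)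
    (hK : ∀ l s, Scanning n d x n l s → cost I κ f (K, s) ≤ a + b * σ ^ l)
    (m y l : ℕ) (hm : y + m = n) {s : State} (hs : Scanning n d x y l s) :
    cost I κ f (scan k :: K, s) ≤ κ * (m * (3 * k + 4) + 1 : ℕ)
      + (a + b * σ ^ l * ∏ j ∈ Finset.Ico y n, if I.Below j x then ρ else 1) := by
  induction m generalizing y l s with
  | zero =>
    obtain rfl : y = n := hm
    simpa using (cost_scan_le_of_eq k hs).trans (add_le_add_right (hK l s hs) _)
  | succ m ih =>
    have hy : y < n := by omega
    obtain ⟨u, v, huv, hv1, -, hcost⟩ := cost_scan_le_of_lt k hy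
      (fun s hs => ih (y + 1) l (by omega) hs) (fun s hs => ih (y + 1) (l + d) (by omega) hs) hs
    refine hcost.trans ?_
    rw [Finset.prod_eq_prod_Ico_succ_bot hy]
    set M := ∏ j ∈ Finset.Ico (y + 1) n, if I.Below j x then ρ else 1
    have hfac : u + v * σ ^ d ≤ if I.Below y x then ρ else 1 := by
      split_ifs with h
      · exact hρ u v huv (hv1 h)
      · calc u + v * σ ^ d ≤ u + v * 1 :=
            add_le_add_right (mul_le_mul_right (pow_le_one₀ zero_le hσ) _) _
          _ = 1 := by rw [mul_one, huv]
    calc _ = (κ * (3 * k + 4 : ℕ) + (u + v) * (κ * (m * (3 * k + 4) + 1 : ℕ)))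
            + ((u + v) * a + b * σ ^ l * ((u + v * σ ^ d) * M)) := by ring
      _ ≤ (κ * (3 * k + 4 : ℕ) + (u + v) * (κ * (m * (3 * k + 4) + 1 : ℕ)))
            + ((u + v) * a + b * σ ^ l * ((if I.Below y x then ρ else 1) * M)) := by gcongr
      _ = _ := by
        rw [huv]
        push_cast
        ring

open Classical in
/-- Expectation of the loss. -/
theorem cost_scan_le_linear (k : ℕ) {K : List Prog} {a b : ℝ≥0∞}
    (hK : ∀ l s, Scanning n d x n l s → cost I κ f (K, s) ≤ a + b * l)
    (m y l : ℕ) (hm : y + m = n) {s : State} (hs : Scanning n d x y l s) :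
    cost I κ f (scan k :: K, s) ≤ κ * (m * (3 * k + 4) + 1 : ℕ)
      + (a + b * (l + ∑ j ∈ Finset.Ico y n,
          (d : ℝ≥0∞) * if I.Below j x then 1 else ENNReal.ofReal p ^ k)) := by
  induction m generalizing y l s with
  | zero =>
    obtain rfl : y = n := hm
    simpa using (cost_scan_le_of_eq k hs).trans (add_le_add_right (hK l s hs) _)
  | succ m ih =>
    have hy : y < n := by omega
    obtain ⟨u, v, huv, -, hv2, hcost⟩ := cost_scan_le_of_lt k hy
      (fun s hs => ih (y + 1) l (by omega) hs) (fun s hs => ih (y + 1) (l + d) (by omega) hs) hs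
    refine hcost.trans ?_
    rw [Finset.sum_eq_sum_Ico_succ_bot hy]
    set M := ∑ j ∈ Finset.Ico (y + 1) n,
      (d : ℝ≥0∞) * if I.Below j x then 1 else ENNReal.ofReal p ^ k
    have hv : v ≤ if I.Below y x then 1 else ENNReal.ofReal p ^ k := by
      split_ifs with h
      · exact huv ▸ le_add_self
      · exact hv2 h
    calc _ = (κ * (3 * k + 4 : ℕ) + (u + v) * (κ * (m * (3 * k + 4) + 1 : ℕ)))
            + ((u + v) * a + b * ((u + v) * l + (d * v + (u + v) * M))) := by
          push_cast
          ring
      _ ≤ (κ * (3 * k + 4 : ℕ) + (u + v) * (κ * (m * (3 * k + 4) + 1 : ℕ)))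
            + ((u + v) * a + b * ((u + v) * l
              + (d * (if I.Below y x then 1 else ENNReal.ofReal p ^ k) + (u + v) * M))) := by
          gcongr
      _ = _ := by
        rw [huv]
        push_cast
        ring

/-! ### One trial -/

theorem cost_trial_le (k : ℕ) (hn : 0 < n) {c : ℕ → ℝ≥0∞}
    (hc : ∀ x < n, ∀ s, Scanning n d x 0 1 s → cost I κ f ([scan k], s) ≤ c x)
    {s : State} (hs : Ready n d s) :
    cost I κ f ([trial k], s) ≤ κ * 6 + (n : ℝ≥0∞)⁻¹ * ∑ x ∈ Finset.range n, c x := by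
  have hn0 : (n : ℝ≥0∞) ≠ 0 := by exact_mod_cast hn.ne'
  have hrest : ∀ x < n, cost I κ f ([.seq (.instr (.const 4 1))
      (.seq (.instr (.const 5 0)) (scan k))], s.setReg 0 x) ≤ κ * 4 + c x := by
    intro x hx
    refine (cost_seq_le _ _ _ _).trans ((add_le_add_right ((cost_instr_le _ _ _).trans
      (add_le_add_right ?_ κ)) κ).trans_eq (b := κ + (κ + (κ + (κ + c x)))) (by ring))
    simp only [Instr.run, mean_pure]
    refine (cost_seq_le _ _ _ _).trans (add_le_add_right ((cost_instr_le _ _ _).trans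
      (add_le_add_right ?_ κ)) κ)
    simp only [Instr.run, mean_pure]
    refine hc x hx _ ?_
    obtain ⟨h1, h2, h3⟩ := hs
    constructor <;> try constructor
    all_goals simp [State.setReg, *]
  calc cost I κ f ([trial k], s)
      ≤ κ + (κ + (n : ℝ≥0∞)⁻¹ * ∑ x ∈ Finset.range n, (κ * 4 + c x)) := by
        refine (cost_seq_le _ _ _ _).trans (add_le_add_right ((cost_instr_le _ _ _).trans
          (add_le_add_right ?_ κ)) κ)
        rw [Instr.run, mean_map, hs.size, mean_uniformBelow hn]
        exact mul_le_mul_right (Finset.sum_le_sum fun x hx => hrest x (Finset.mem_range.1 hx)) _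
    _ = κ + (κ + ((n : ℝ≥0∞)⁻¹ * n * (κ * 4) + (n : ℝ≥0∞)⁻¹ * ∑ x ∈ Finset.range n, c x)) := by
        rw [Finset.sum_add_distrib, Finset.sum_const, Finset.card_range, nsmul_eq_mul]
        ring
    _ = _ := by
        rw [ENNReal.inv_mul_cancel hn0 (ENNReal.natCast_ne_top n)]
        ring

/-- By Markov's inequality, a candidate of rank below `n / (12 d)` is rejected with probability at
most `1 / 2`.  Here `v` is the cost of a rejection, and `e` that of an acceptance. -/
theorem cost_scan_le_of_rank_small (k : ℕ) (hn : 3 ≤ n)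
    (hd : 12 * (d : ℝ≥0∞) * ENNReal.ofReal p ^ k ≤ 1) (hx : I.rank x * (12 * d) < n) {e v : ℝ≥0∞}
    (hf : ∀ l s, Scanning n d x n l s → f s ≤ if n < l then v else e)
    {s : State} (hs : Scanning n d x 0 1 s) :
    cost I κ f ([scan k], s) ≤ κ * (n * (3 * k + 4) + 1 : ℕ) + (e + v * 2⁻¹) := by
  classical
  have hn0 : (n : ℝ≥0∞) ≠ 0 := by
    have : n ≠ 0 := by omega
    exact_mod_cast this
  have hlin : ∀ l s, Scanning n d x n l s → cost I κ f ([], s) ≤ e + v * (n : ℝ≥0∞)⁻¹ * l := by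
    intro l s hs
    rw [cost_nil]
    refine (hf l s hs).trans ?_
    split_ifs with h
    · refine le_add_left ?_
      calc v = v * ((n : ℝ≥0∞)⁻¹ * n) := by
            rw [ENNReal.inv_mul_cancel hn0 (ENNReal.natCast_ne_top n), mul_one]
        _ ≤ v * ((n : ℝ≥0∞)⁻¹ * l) := by gcongr
        _ = _ := by ring
    · exact le_self_add
  refine (cost_scan_le_linear k hlin n 0 1 (by simp) hs).trans ?_
  gcongr _ + (e + ?_)
  rw [mul_assoc]
  gcongr v * ?_
  -- the expected loss is at most `1 + n / 12 + n / 12 ≤ n / 2`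
  set P := ENNReal.ofReal p ^ k
  have hsum : ∑ j ∈ Finset.Ico 0 n, (d : ℝ≥0∞) * (if I.Below j x then 1 else P)
      ≤ d * I.rank x + n * (d * P) := by
    calc _ ≤ ∑ j ∈ Finset.Ico 0 n, ((d : ℝ≥0∞) * (if I.Below j x then 1 else 0) + d * P) := by
          refine Finset.sum_le_sum fun j _ => ?_
          split_ifs <;> simp
      _ = _ := by
          rw [Finset.sum_add_distrib, ← Finset.mul_sum, Finset.sum_boole, Instance.rank]
          simp
  have hrank : (I.rank x : ℝ≥0∞) * (12 * d) ≤ n := by exact_mod_cast hx.le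
  have hthree : (3 : ℝ≥0∞) ≤ n := by exact_mod_cast hn
  have htotal : ((1 : ℕ) + ∑ j ∈ Finset.Ico 0 n, (d : ℝ≥0∞) * (if I.Below j x then 1 else P)) * 2
      ≤ n := by
    have h12 : (12 : ℝ≥0∞) ≠ 0 := by norm_num
    rw [← ENNReal.mul_le_mul_iff_right (a := 12) (by norm_num) (by norm_num)]
    calc _ ≤ 12 * (((1 : ℕ) + (d * I.rank x + n * (d * P))) * 2) := by gcongr
      _ = 8 * 3 + 2 * (I.rank x * (12 * d)) + 2 * n * (12 * d * P) := by push_cast; ring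
      _ ≤ 8 * n + 2 * n + 2 * n * 1 := by gcongr
      _ = 12 * n := by ring
  rw [mul_comm, ← div_eq_mul_inv, ENNReal.div_le_iff hn0 (ENNReal.natCast_ne_top n), mul_comm,
    ← div_eq_mul_inv, ENNReal.le_div_iff_mul_le (by simp) (by simp)]
  exact htotal

/-- By a Chernoff bound, a candidate of rank at least `m` is accepted only with probability
`ρ ^ m / σ ^ n`. Here `v` bounds the cost of a rejection, and `v + e` that of an acceptance. -/
theorem cost_scan_le_of_rank_large (k : ℕ) {σ ρ : ℝ≥0∞} (hσ0 : σ ≠ 0) (hσ : σ ≤ 1) (hρ1 : ρ ≤ 1)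
    (hρ : ∀ u v : ℝ≥0∞, u + v = 1 → ENNReal.ofReal (1 - p) ^ k ≤ v → u + v * σ ^ d ≤ ρ)
    {m : ℕ} (hx : m ≤ I.rank x) {e v : ℝ≥0∞}
    (hf : ∀ l s, Scanning n d x n l s → f s ≤ if n < l then v else v + e)
    {s : State} (hs : Scanning n d x 0 1 s) :
    cost I κ f ([scan k], s)
      ≤ κ * (n * (3 * k + 4) + 1 : ℕ) + (v + e * ((σ ^ n)⁻¹ * ρ ^ m)) := by
  classical
  have hσtop : σ ≠ ∞ := ne_top_of_le_ne_top ENNReal.one_ne_top hσ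
  have hexp : ∀ l s, Scanning n d x n l s →
      cost I κ f ([], s) ≤ v + e * (σ ^ n)⁻¹ * σ ^ l := by
    intro l s hs
    rw [cost_nil]
    refine (hf l s hs).trans ?_
    split_ifs with h
    · exact le_self_add
    · gcongr
      calc e = e * ((σ ^ n)⁻¹ * σ ^ n) := by
            rw [ENNReal.inv_mul_cancel (pow_ne_zero n hσ0) (ENNReal.pow_ne_top hσtop), mul_one]
        _ ≤ e * ((σ ^ n)⁻¹ * σ ^ l) := by
            gcongr e * (_ * ?_)
            exact pow_le_pow_of_le_one zero_le hσ (not_lt.1 h)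
        _ = _ := by ring
  refine (cost_scan_le_exp k hσ hρ hexp n 0 1 (by simp) hs).trans ?_
  rw [mul_assoc, mul_assoc]
  gcongr _ + (v + e * (_ * ?_))
  rw [Finset.prod_ite, Finset.prod_const, Finset.prod_const_one, mul_one, pow_one,
    ← Finset.range_eq_Ico]
  calc σ * ρ ^ I.rank x ≤ 1 * ρ ^ m :=
        mul_le_mul' hσ (pow_le_pow_of_le_one zero_le hρ1 hx)
    _ = _ := one_mul _

/-! ### The whole search -/

/-- Since at least `n / D` elements have a rank below `n / D`, a random candidate is one of them
with probability at least `1 / D`. -/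
theorem average_rank_le (I : Instance n p) (hn : 0 < n) {D : ℕ} (hD : 0 < D) (v : ℝ≥0∞) :
    v * (2 * D : ℝ≥0∞)⁻¹ + (n : ℝ≥0∞)⁻¹ *
      ∑ x ∈ Finset.range n, (if I.rank x * D < n then v * 2⁻¹ else v) ≤ v := by
  classical
  have hn0 : (n : ℝ≥0∞) ≠ 0 := by exact_mod_cast hn.ne'
  have hD0 : (D : ℝ≥0∞) ≠ 0 := by exact_mod_cast hD.ne'
  have hcancel := ENNReal.inv_mul_cancel hn0 (ENNReal.natCast_ne_top n)
  obtain ⟨m, hmn, hmD, hm⟩ : ∃ m ≤ n, n ≤ m * D ∧ ∀ i < m, i * D < n := by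
    refine ⟨(n + D - 1) / D, ?_, ?_, fun i hi => ?_⟩
    · rw [Nat.div_le_iff_le_mul hD]
      have : n + D ≤ n * D + 1 := by nlinarith
      omega
    · have := Nat.lt_mul_div_succ (n + D - 1) hD
      rw [mul_comm]
      rw [Nat.mul_add] at this
      omega
    · have := (Nat.le_div_iff_mul_le hD).1 (Nat.succ_le_of_lt hi)
      rw [Nat.succ_mul] at this
      omega
  set N := ((Finset.range n).filter (I.rank · * D < n)).card with hN
  have hcard : n ≤ N * D := by
    refine hmD.trans (Nat.mul_le_mul_right D ((I.le_card_rank_lt hmn).trans ?_))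
    exact Finset.card_le_card fun x hx => by
      simp only [Finset.mem_filter] at hx ⊢
      exact ⟨hx.1, hm _ hx.2⟩
  have hcard' : (n : ℝ≥0∞) ≤ N * D := by exact_mod_cast hcard
  have hsum : (N : ℝ≥0∞) * (v * 2⁻¹)
      + ∑ x ∈ Finset.range n, (if I.rank x * D < n then v * 2⁻¹ else v) = n * v := by
    calc _ = ∑ x ∈ Finset.range n, ((if I.rank x * D < n then v * 2⁻¹ else 0)
          + (if I.rank x * D < n then v * 2⁻¹ else v)) := by
          rw [Finset.sum_add_distrib, ← Finset.sum_filter, Finset.sum_const, nsmul_eq_mul]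
      _ = ∑ x ∈ Finset.range n, v := by
          refine Finset.sum_congr rfl fun x _ => ?_
          split_ifs
          · rw [← mul_add, ENNReal.inv_two_add_inv_two, mul_one]
          · exact zero_add v
      _ = _ := by simp
  have hinv : (D : ℝ≥0∞)⁻¹ ≤ (n : ℝ≥0∞)⁻¹ * N := by
    calc (D : ℝ≥0∞)⁻¹ = (n : ℝ≥0∞)⁻¹ * n * (D : ℝ≥0∞)⁻¹ := by rw [hcancel, one_mul]
      _ ≤ (n : ℝ≥0∞)⁻¹ * (N * D) * (D : ℝ≥0∞)⁻¹ := by gcongr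
      _ = (n : ℝ≥0∞)⁻¹ * N * (D * (D : ℝ≥0∞)⁻¹) := by ring
      _ = _ := by rw [ENNReal.mul_inv_cancel hD0 (ENNReal.natCast_ne_top D), mul_one]
  calc _ ≤ v * 2⁻¹ * ((n : ℝ≥0∞)⁻¹ * N) + (n : ℝ≥0∞)⁻¹ *
        ∑ x ∈ Finset.range n, (if I.rank x * D < n then v * 2⁻¹ else v) := by
        rw [ENNReal.mul_inv (by simp) (by simp), ← mul_assoc]
        gcongr
    _ = (n : ℝ≥0∞)⁻¹ * ((N : ℝ≥0∞) * (v * 2⁻¹)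
      + ∑ x ∈ Finset.range n, (if I.rank x * D < n then v * 2⁻¹ else v)) := by ring
    _ = v := by rw [hsum, ← mul_assoc, hcancel, one_mul]

/-- Expected cost of the search if halting costs at most `e₀` for one of the `3 n / 4` smallest
elements, and at most `e₀ + v + e₁` otherwise.  With probability at least `1 / (24 d)` a trial
saves the cost `v` of the trials after it, and this has to pay for the other costs of a trial: its
running time, the cost `e₀`, and the cost `e₁` times the probability of a wrong acceptance. -/
theorem cost_search_le (k : ℕ) (hn : 3 ≤ n) (hd0 : 0 < d)
    (hd : 12 * (d : ℝ≥0∞) * ENNReal.ofReal p ^ k ≤ 1)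
    {σ ρ : ℝ≥0∞} (hσ0 : σ ≠ 0) (hσ : σ ≤ 1) (hρ1 : ρ ≤ 1)
    (hρ : ∀ u v : ℝ≥0∞, u + v = 1 → ENNReal.ofReal (1 - p) ^ k ≤ v → u + v * σ ^ d ≤ ρ)
    {e₀ e₁ v : ℝ≥0∞} (hf : ∀ s, κ + f s ≤ e₀ + v + e₁)
    (hf' : ∀ s, s.reg 0 < n → I.rank (s.reg 0) < 3 * n / 4 → κ + f s ≤ e₀)
    (hv : κ * (n * (3 * k + 4) + 8 : ℕ) + e₀ + e₁ * ((σ ^ n)⁻¹ * ρ ^ (3 * n / 4))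
      ≤ v * (2 * (12 * d : ℕ) : ℝ≥0∞)⁻¹) :
    cost I κ f ([search k d], initState n) ≤ κ * 8 + v := by
  classical
  have hloop : ∀ s, Ready n d s → n < s.reg 4 → cost I κ f ([.loop 1 4 (trial k)], s) ≤ v := by
    intro s hs hlt
    refine cost_loop_le_of_invariant (Ready n d) v ?_ hs (by rwa [hs.size])
    intro g hg s hs _
    have hg' : ∀ x l s, Scanning n d x n l s → g s ≤ if n < l then v else κ + f s := by
      intro x l s hs
      simpa only [hs.size, hs.loss] using hg s hs.toReady
    set X := κ * (n * (3 * k + 4) + 1 : ℕ) + (e₀ + e₁ * ((σ ^ n)⁻¹ * ρ ^ (3 * n / 4))) with hX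
    have hscan : ∀ x < n, ∀ s, Scanning n d x 0 1 s → cost I κ g ([scan k], s)
        ≤ X + (if I.rank x * (12 * d) < n then v * 2⁻¹ else v) := by
      intro x hx s hs
      by_cases hsmall : I.rank x < 3 * n / 4
      · have hacc : ∀ l s, Scanning n d x n l s → g s ≤ if n < l then v else e₀ := by
          intro l s hs
          refine (hg' x l s hs).trans ?_
          split_ifs
          · exact le_rfl
          · exact hf' s (by rwa [hs.candidate]) (by rwa [hs.candidate])
        split_ifs with hlow
        · refine (cost_scan_le_of_rank_small k hn hd hlow hacc hs).trans ?_
          rw [hX, ← add_assoc, ← add_assoc]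
          exact add_le_add_left le_self_add _
        · have hbound : ∀ l s, Scanning n d x n l s → cost I κ g ([], s) ≤ e₀ + v + 0 * l := by
            intro l s hs
            rw [cost_nil, zero_mul, add_zero]
            refine (hacc l s hs).trans ?_
            split_ifs
            · exact le_add_self
            · exact le_self_add
          refine (cost_scan_le_linear k hbound n 0 1 (by simp) hs).trans ?_
          rw [zero_mul, add_zero, hX, ← add_assoc, ← add_assoc]
          exact add_le_add_left le_self_add _
      · have hlow : ¬ I.rank x * (12 * d) < n := by
          have : I.rank x * 12 ≤ I.rank x * (12 * d) := Nat.mul_le_mul_left _ (by omega)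
          omega
        rw [if_neg hlow]
        have hacc : ∀ l s, Scanning n d x n l s →
            g s ≤ if n < l then e₀ + v else e₀ + v + e₁ := by
          intro l s hs
          refine (hg' x l s hs).trans ?_
          split_ifs
          · exact le_add_self
          · exact hf s
        refine (cost_scan_le_of_rank_large k hσ0 hσ hρ1 hρ (not_lt.1 hsmall) hacc hs).trans_eq ?_
        rw [hX]
        ring
    have hn0 : (n : ℝ≥0∞) ≠ 0 := by
      have : n ≠ 0 := by omega
      exact_mod_cast this
    calc κ + cost I κ g ([trial k], s)
        ≤ κ + (κ * 6 + (n : ℝ≥0∞)⁻¹ * ∑ x ∈ Finset.range n,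
            (X + (if I.rank x * (12 * d) < n then v * 2⁻¹ else v))) :=
          add_le_add_right (cost_trial_le k (by omega) hscan hs) κ
      _ = κ + (κ * 6 + ((n : ℝ≥0∞)⁻¹ * n * X + (n : ℝ≥0∞)⁻¹ * ∑ x ∈ Finset.range n,
            (if I.rank x * (12 * d) < n then v * 2⁻¹ else v))) := by
          rw [Finset.sum_add_distrib, Finset.sum_const, Finset.card_range, nsmul_eq_mul]
          ring
      _ = (κ * (n * (3 * k + 4) + 8 : ℕ) + e₀ + e₁ * ((σ ^ n)⁻¹ * ρ ^ (3 * n / 4)))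
            + (n : ℝ≥0∞)⁻¹ * ∑ x ∈ Finset.range n,
            (if I.rank x * (12 * d) < n then v * 2⁻¹ else v) := by
          rw [ENNReal.inv_mul_cancel hn0 (ENNReal.natCast_ne_top n), hX]
          push_cast
          ring
      _ ≤ v * (2 * (12 * d : ℕ) : ℝ≥0∞)⁻¹ + (n : ℝ≥0∞)⁻¹ * ∑ x ∈ Finset.range n,
            (if I.rank x * (12 * d) < n then v * 2⁻¹ else v) := by gcongr
      _ ≤ v := average_rank_le I (by omega) (by omega) v
  have hstep : ∀ (i : Instr) (Q : Prog) (s s' : State) (C : ℝ≥0∞), i.run I s = PMF.pure s' →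
      cost I κ f ([Q], s') ≤ C → cost I κ f ([.seq (.instr i) Q], s) ≤ κ + (κ + C) := by
    intro i Q s s' C hi hC
    refine (cost_seq_le _ _ _ _).trans (add_le_add_right ((cost_instr_le _ _ _).trans
      (add_le_add_right ?_ κ)) κ)
    rwa [hi, mean_pure]
  refine (hstep _ _ _ _ _ rfl <| hstep _ _ _ _ _ rfl <| hstep _ _ _ _ _ rfl <|
    hstep _ _ _ _ _ rfl <| hloop _ ⟨?_, ?_, ?_⟩ ?_).trans_eq (by ring)
  all_goals simp [State.setReg, initState]

/-! ### Choice of the constants -/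

/-- Numbers `k` of comparisons in a duel, and `d` of units for a lost duel. -/
theorem exists_duel_parameters (p : ℝ) (hp0 : 0 ≤ p) (hp : p < 1 / 2) :
    ∃ k d : ℕ, 0 < d ∧ 12 * (d : ℝ) * p ^ k ≤ 1 ∧ (1 - (1 - p) ^ k / 4) ^ d ≤ 1 / 2 := by
  obtain ⟨k, hk⟩ := exists_pow_lt_of_lt_one (show (0 : ℝ) < 1 / 60 by norm_num)
    (show p / (1 - p) < 1 by rw [div_lt_one (by linarith)]; linarith)
  have hq0 : 0 < (1 - p) ^ k := pow_pos (by linarith) k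
  have hq1 : (1 - p) ^ k ≤ 1 := pow_le_one₀ (by linarith) (by linarith)
  rw [div_pow, div_lt_iff₀ hq0] at hk
  set q := (1 - p) ^ k
  have hd4 : 4 / q ≤ ⌈4 / q⌉₊ := Nat.le_ceil _
  have hd5 : (⌈4 / q⌉₊ : ℝ) * q ≤ 5 := by
    have h := (Nat.ceil_lt_add_one (show 0 ≤ 4 / q by positivity)).le
    calc (⌈4 / q⌉₊ : ℝ) * q ≤ (4 / q + 1) * q := by gcongr
      _ = 4 + q := by field_simp
      _ ≤ 5 := by linarith
  refine ⟨k, ⌈4 / q⌉₊, Nat.ceil_pos.2 (by positivity), ?_, ?_⟩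
  · have : (⌈4 / q⌉₊ : ℝ) * p ^ k ≤ ⌈4 / q⌉₊ * (1 / 60 * q) := by gcongr
    linarith
  · have hbern := one_add_mul_le_pow (show (-2 : ℝ) ≤ q / 4 by linarith) ⌈4 / q⌉₊
    have htwo : 2 ≤ (1 + q / 4) ^ ⌈4 / q⌉₊ := by
      have := (div_le_iff₀ hq0).1 hd4
      linarith
    have hprod : (1 - q / 4) ^ ⌈4 / q⌉₊ * (1 + q / 4) ^ ⌈4 / q⌉₊ ≤ 1 := by
      rw [← mul_pow]
      exact pow_le_one₀ (by nlinarith) (by nlinarith)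
    have hpos : 0 ≤ (1 - q / 4) ^ ⌈4 / q⌉₊ := pow_nonneg (by linarith) _
    nlinarith

/-- A base `c > 1` such that `v = c⁻ⁿ` satisfies the requirement of `cost_search_le` on the
probability of a wrong output. -/
theorem exists_base {q D : ℝ} (hq0 : 0 < q) (hq1 : q ≤ 1) (hD : 1 ≤ D) :
    ∃ c : ℝ, 1 < c ∧ ∀ n : ℕ, 3 ≤ n →
      (1 - (c ^ n)⁻¹) * (((1 - q / 4) ^ n)⁻¹ * (1 - q / 2) ^ (3 * n / 4)) ≤ (c ^ n)⁻¹ * D⁻¹ := by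
  set R := Real.sqrt ((1 - q / 4) ^ 2 / (1 - q / 2)) with hR
  have hρ : 0 < 1 - q / 2 := by linarith
  have hσ : 0 < 1 - q / 4 := by linarith
  have hR2 : R ^ 2 = (1 - q / 4) ^ 2 / (1 - q / 2) := Real.sq_sqrt (by positivity)
  have hR1 : 1 < R := by
    rw [hR, Real.lt_sqrt zero_le_one, lt_div_iff₀ hρ]
    nlinarith
  have hD0 : 0 < D := by linarith
  refine ⟨1 + (R - 1) / D, by simpa using div_pos (by linarith) hD0, fun n hn => ?_⟩
  set c := 1 + (R - 1) / D with hc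
  have hc0 : 0 < c ^ n := pow_pos (by have := div_pos (show 0 < R - 1 by linarith) hD0; linarith) n
  -- `c` is a convex combination of `1` and `R`
  have hconv : c ^ n - 1 ≤ R ^ n * D⁻¹ := by
    have h := (convexOn_pow n).2 (show (1 : ℝ) ∈ Set.Ici 0 by simp)
      (show R ∈ Set.Ici 0 by simpa using (by linarith : 0 ≤ R))
      (show 0 ≤ 1 - D⁻¹ by have := inv_le_one_of_one_le₀ hD; linarith)
      (inv_nonneg.2 hD0.le) (by ring)
    simp only [smul_eq_mul, one_pow, mul_one] at h
    have hcc : 1 - D⁻¹ + D⁻¹ * R = c := by rw [hc]; ring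
    rw [hcc] at h
    have := inv_nonneg.2 hD0.le
    linarith
  have hβ : R ^ n * (((1 - q / 4) ^ n)⁻¹ * (1 - q / 2) ^ (3 * n / 4)) ≤ 1 := by
    set m := 3 * n / 4 with hm
    have hnm : n ≤ 2 * m := by omega
    have hbase : 1 ≤ R * (1 - q / 4)⁻¹ := by
      rw [← div_eq_mul_inv, le_div_iff₀ hσ]
      linarith
    calc R ^ n * (((1 - q / 4) ^ n)⁻¹ * (1 - q / 2) ^ m)
        = (R * (1 - q / 4)⁻¹) ^ n * (1 - q / 2) ^ m := by rw [mul_pow, inv_pow]; ring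
      _ ≤ (R * (1 - q / 4)⁻¹) ^ (2 * m) * (1 - q / 2) ^ m := by gcongr
      _ = (R ^ 2 * ((1 - q / 4) ^ 2)⁻¹ * (1 - q / 2)) ^ m := by
          rw [pow_mul, mul_pow R, inv_pow, ← mul_pow]
      _ = 1 := by
          rw [hR2]
          have : (1 - q / 4) ^ 2 / (1 - q / 2) * ((1 - q / 4) ^ 2)⁻¹ * (1 - q / 2) = 1 := by
            rw [div_eq_mul_inv, mul_right_comm _ _ ((1 - q / 4) ^ 2)⁻¹,
              mul_inv_cancel₀ (by positivity), one_mul, inv_mul_cancel₀ hρ.ne']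
          rw [this, one_pow]
  set β := ((1 - q / 4) ^ n)⁻¹ * (1 - q / 2) ^ (3 * n / 4)
  have hβ0 : 0 ≤ β := by positivity
  calc (1 - (c ^ n)⁻¹) * β = (c ^ n)⁻¹ * ((c ^ n - 1) * β) := by field_simp
    _ ≤ (c ^ n)⁻¹ * (R ^ n * D⁻¹ * β) := by gcongr
    _ = (c ^ n)⁻¹ * (D⁻¹ * (R ^ n * β)) := by ring
    _ ≤ (c ^ n)⁻¹ * (D⁻¹ * 1) := by gcongr
    _ = _ := by rw [mul_one]

/-- The factor that a smaller opponent contributes to the exponential moment of the loss. -/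
theorem loss_factor_le {q : ℝ} (hq1 : q ≤ 1) (hd : (1 - q / 4) ^ d ≤ 1 / 2)
    (u v : ℝ≥0∞) (huv : u + v = 1) (hv : ENNReal.ofReal q ≤ v) :
    u + v * ENNReal.ofReal (1 - q / 4) ^ d ≤ ENNReal.ofReal (1 - q / 2) := by
  have hu1 : u ≠ ∞ := ne_top_of_le_ne_top ENNReal.one_ne_top (huv ▸ le_self_add)
  have hv1 : v ≠ ∞ := ne_top_of_le_ne_top ENNReal.one_ne_top (huv ▸ le_add_self)
  lift u to NNReal using hu1
  lift v to NNReal using hv1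
  have huv' : (u : ℝ) + v = 1 := by exact_mod_cast huv
  have hv' : q ≤ v := by
    rw [← ENNReal.ofReal_coe_nnreal] at hv
    exact (ENNReal.ofReal_le_ofReal_iff v.2).1 hv
  rw [← ENNReal.ofReal_pow (by linarith), ← ENNReal.ofReal_coe_nnreal,
    ← ENNReal.ofReal_coe_nnreal (p := v), ← ENNReal.ofReal_mul v.coe_nonneg,
    ← ENNReal.ofReal_add u.coe_nonneg (mul_nonneg v.coe_nonneg (pow_nonneg (by linarith) d))]
  refine ENNReal.ofReal_le_ofReal ?_
  have := mul_le_mul_of_nonneg_left hd v.coe_nonneg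
  linarith

theorem logb_logb_pos : 0 < Real.logb 2 (Real.logb 2 3) := by
  refine Real.logb_pos one_lt_two ?_
  rw [Real.lt_logb_iff_rpow_lt one_lt_two (by norm_num)]
  norm_num

theorem logb_logb_three_le (hn : 3 ≤ n) :
    Real.logb 2 (Real.logb 2 3) ≤ Real.logb 2 (Real.logb 2 n) := by
  have hn' : (3 : ℝ) ≤ n := by exact_mod_cast hn
  exact Real.logb_le_logb_of_le one_lt_two (Real.logb_pos one_lt_two (by norm_num))
    (Real.logb_le_logb_of_le one_lt_two (by norm_num) hn')

end FTMin
end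

open FTMin

theorem theorem18 (p : ℝ) (hp0 : 0 ≤ p) (hp : p < 1 / 2) :
    ∃ P : FTMin.Prog, ∃ C : ℝ, ∃ c : ℝ, 1 < c ∧
      ∀ n : ℕ, 3 ≤ n → ∀ I : FTMin.Instance n p,
        FTMin.expectedTime P I ≤
            ENNReal.ofReal (C * (n * Real.logb 2 (Real.logb 2 n))) ∧
          ENNReal.ofReal (1 - (c ^ n)⁻¹) ≤ FTMin.successProb P I (3 * n / 4) := by
  obtain ⟨k, d, hd0, hd, hτ⟩ := exists_duel_parameters p hp0 hp
  have hq0 : 0 < (1 - p) ^ k := pow_pos (by linarith) k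
  have hq1 : (1 - p) ^ k ≤ 1 := pow_le_one₀ (by linarith) (by linarith)
  obtain ⟨c, hc1, hc⟩ := exists_base (D := (2 * (12 * d : ℕ) : ℝ)) hq0 hq1 (by
    have : (1 : ℝ) ≤ d := by exact_mod_cast hd0
    push_cast
    linarith)
  have hd' : 12 * (d : ℝ≥0∞) * ENNReal.ofReal p ^ k ≤ 1 := by
    have h := ENNReal.ofReal_le_ofReal hd
    rwa [ENNReal.ofReal_mul (by positivity), ENNReal.ofReal_mul (by norm_num),
      ENNReal.ofReal_pow hp0, ENNReal.ofReal_natCast, ENNReal.ofReal_ofNat,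
      ENNReal.ofReal_one] at h
  set q := (1 - p) ^ k with hq
  set σ := ENNReal.ofReal (1 - q / 4) with hσ
  set ρ := ENNReal.ofReal (1 - q / 2) with hρ
  have hσ0 : σ ≠ 0 := by
    rw [hσ, ne_eq, ENNReal.ofReal_eq_zero, not_le]
    linarith
  have hσ1 : σ ≤ 1 := ENNReal.ofReal_le_one.2 (by linarith)
  have hρ1 : ρ ≤ 1 := ENNReal.ofReal_le_one.2 (by linarith)
  have hfac : ∀ u v : ℝ≥0∞, u + v = 1 → ENNReal.ofReal (1 - p) ^ k ≤ v → u + v * σ ^ d ≤ ρ := by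
    intro u v huv hv
    rw [← ENNReal.ofReal_pow (by linarith)] at hv
    exact loss_factor_le hq1 hτ u v huv hv
  have hD0 : (2 * (12 * d : ℕ) : ℝ≥0∞) ≠ 0 := by
    have : 2 * (12 * d) ≠ 0 := by omega
    exact_mod_cast this
  have hDtop : (2 * (12 * d : ℕ) : ℝ≥0∞) ≠ ∞ := by
    exact_mod_cast ENNReal.natCast_ne_top (2 * (12 * d))
  refine ⟨search k d, (8 + 24 * d * (3 * k + 7)) / Real.logb 2 (Real.logb 2 3), c, hc1,
    fun n hn I => ?_⟩
  have hn' : (3 : ℝ) ≤ n := by exact_mod_cast hn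
  have htime : expectedTime (search k d) I ≤
      (8 + (n * (3 * k + 4) + 8 + 1) * (2 * (12 * d)) : ℕ) := by
    refine (expectedTime_le_cost _).trans ((cost_search_le k hn hd0 hd' hσ0 hσ1 hρ1 hfac (e₀ := 1)
      (e₁ := 0) (v := ((n * (3 * k + 4) + 8 + 1 : ℕ) * (2 * (12 * d : ℕ)))) ?_ ?_ ?_).trans_eq ?_)
    · intro s
      rw [add_zero, add_zero]
      exact le_self_add
    · intro s _ _
      rw [add_zero]
    · rw [zero_mul, add_zero, one_mul, mul_assoc, ENNReal.mul_inv_cancel hD0 hDtop, mul_one]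
      push_cast
      exact le_rfl
    · push_cast
      ring
  refine ⟨htime.trans ?_, ?_⟩
  · rw [← ENNReal.ofReal_natCast]
    refine ENNReal.ofReal_le_ofReal ?_
    have hlog := logb_logb_three_le hn
    have hlog0 := logb_logb_pos
    calc ((8 + (n * (3 * k + 4) + 8 + 1) * (2 * (12 * d)) : ℕ) : ℝ)
        = 8 + 24 * d * ((3 * k + 4) * n + 9) := by push_cast; ring
      _ ≤ 8 * n + 24 * d * ((3 * k + 4) * n + 3 * n) := by gcongr <;> linarith
      _ = (8 + 24 * d * (3 * k + 7)) / Real.logb 2 (Real.logb 2 3)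
            * (n * Real.logb 2 (Real.logb 2 3)) := by field_simp; ring
      _ ≤ _ := by gcongr
  · have hfin : expectedTime (search k d) I ≠ ∞ :=
      ne_top_of_le_ne_top (ENNReal.natCast_ne_top _) htime
    have hc0 : 0 < c ^ n := pow_pos (by linarith) n
    have hcinv : (c ^ n)⁻¹ ≤ 1 := inv_le_one_of_one_le₀ (one_le_pow₀ hc1.le)
    have hsplit : ENNReal.ofReal (c ^ n)⁻¹ + ENNReal.ofReal (1 - (c ^ n)⁻¹) = 1 := by
      rw [← ENNReal.ofReal_add (by positivity) (by linarith), add_sub_cancel, ENNReal.ofReal_one]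
    have hwrong : cost I 0 (wrongOutput I (3 * n / 4)) ([search k d], initState n)
        ≤ ENNReal.ofReal (c ^ n)⁻¹ := by
      refine (cost_search_le k hn hd0 hd' hσ0 hσ1 hρ1 hfac (e₀ := 0)
        (e₁ := ENNReal.ofReal (1 - (c ^ n)⁻¹)) (v := ENNReal.ofReal (c ^ n)⁻¹) ?_ ?_ ?_).trans_eq
        (by rw [zero_mul, zero_add])
      · intro s
        rw [zero_add, zero_add, hsplit, wrongOutput]
        split_ifs <;> simp
      · intro s hs hr
        rw [zero_add, wrongOutput, if_pos]
        refine ⟨⟨s.reg 0, hs⟩, rfl, ?_⟩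
        rw [Instance.IsSmall, ← I.rank_eq_ncard]
        exact hr
      · have h := ENNReal.ofReal_le_ofReal (hc n hn)
        have hσn : 0 < (1 - q / 4) ^ n := pow_pos (by linarith) n
        rw [ENNReal.ofReal_mul (by linarith), ENNReal.ofReal_mul (inv_nonneg.2 hσn.le),
          ENNReal.ofReal_inv_of_pos hσn, ENNReal.ofReal_pow (by linarith),
          ENNReal.ofReal_pow (by linarith), ENNReal.ofReal_mul (by positivity),
          ENNReal.ofReal_inv_of_pos (x := 2 * _) (by positivity),
          ENNReal.ofReal_mul (by norm_num), ENNReal.ofReal_natCast, ENNReal.ofReal_ofNat] at h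
        simpa using h
    have h := one_le_successProb_add_cost (I := I) (search k d) (3 * n / 4) hfin
    rw [ENNReal.ofReal_sub _ (by positivity), ENNReal.ofReal_one, tsub_le_iff_right]
    exact h.trans (add_le_add_right hwrong _)
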